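/- Let $n\ge 1$ and let $t_j$, $j\in\mathbb Z$, be variables with $t_{j+n}=t_j$; put $\mathbb Z[t]_n=\mathbb Z[t_0,\dots,t_{n-1}]$. Let $\mathcal T_{\infty,n}$ be the scheme glued from the charts $U_i=\operatorname{Spec}\mathbb Z[t]_n[X_i,Y_{i+1}]/(X_iY_{i+1}-t_i)$, $i\in\mathbb Z$, where $V_i=U_{i-1}\cap U_i=\operatorname{Spec}\mathbb Z[t]_n[X_i,X_i^{-1}]$ and $Y_i=X_i^{-1}$ (so $X_{i-1}=t_{i-1}X_i$). It contains the open torus with coordinates $t_0,\dots,t_{n-1},X_0$, whose character lattice is $M=\mathbb Z f\oplus\bigoplus_{j=0}^{n-1}\mathbb Z e_j$, with $z^{e_j}=t_j$, $z^f=X_0$. Let $L$ be the line bundle with generators $z_i$ on $U_i$ and transition rule $z_{i-1}=X_iz_i$ on $V_i$. Let $\phi:\mathbb R\to\mathbb R_{\ge 0}$ be the piecewise linear function with $\phi(t)=tk-\frac{k(k+1)}2$ for $k\le t\le k+1$, $k\in\mathbb Z$, and for $p\in\mathbb Q$ set $$w_p=-pf+\sum_{j=0}^{n-1}n\,\phi\Bigl(\frac{j-p}{n}\Bigr)e_j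 .$$ Identify $z_i$ with the character $z^{w_i}$; then for $m\ge 1$ and $p\in\frac1m\mathbb Z$ the character $z^{mw_p}$ is a global section of $L^m$. The group $\mathbb Z$ acts on $(\mathcal T_{\infty,n},L)$ through $\tau$ with $\tau^*t_j=t_{j-1}$, $\tau^*X_i=X_{i-1}$, $\tau^*z_i=z_{i-1}$. Let $\hat{\mathcal T}$ be the formal completion of $\mathcal T_{\infty,n}$ along $t_0=\dots=t_{n-1}=0$. The $n$-Tate curve $T_n$ over $\mathbb Z[[t_0,\dots,t_{n-1}]]$ is the algebraization of $\hat{\mathcal T}/n\mathbb Z$, polarized by $L$, and $H^0(T_n,L^m)=H^0(\hat{\mathcal T},L^m)^{n\mathbb Z}$. For $m\ge 1$ and $p\in\frac1m\mathbb Z$ the theta function $\theta_{m,p}\in H^0(T_n,L^m)$ is $$\theta_{m,p}=\sum_{i\in\mathbb Z}z^{m w_{-p+in}} ,$$ a sum which is finite on every finite order thickening of the central fibre in every chart $U_i$. **Proposition.** For $m_1,m_2\ge 1$, $p_1\in\frac1{m_1}\mathbb Z$ and $p_2\in\frac1{m_2}\mathbb Z$ one has, in $H^0(T_n,L^{m_1+m_2})$,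 $$\theta_{m_1,p_1}\,\theta_{m_2,p_2}=\sum_{k\in\mathbb Z}\theta_{m_1+m_2,\,E(p_1,p_2+kn)}\cdot\prod_{j=0}^{n-1}t_j^{\,n\lambda\left(\frac{p_1+j}{n},\,\frac{p_2+j}{n}+k\right)},$$ where $$E(a,b)=\frac{m_1a+m_2b}{m_1+m_2},\qquad \lambda(a,b)=m_1\phi(a)+m_2\phi(b)-(m_1+m_2)\,\phi(E(a,b)).$$ Here all the exponents $n\lambda(\dots)$ are nonnegative integers, and the sum over $k$ converges in the $(t)$-adic topology. -/

import Mathlib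

/-!
The formal `n`-Tate curve, the powers of its polarization `L`, and theta functions.

The toric scheme `𝒯_{∞,n}` over `ℤ[t]_n = ℤ[t_j : j ∈ ℤ/n]` is glued from the affine charts
`U_i = Spec ℤ[t]_n[X_i, Y_{i+1}]/(X_i Y_{i+1} - t_i)`, `i ∈ ℤ`, with
`V_{i+1} = U_i ∩ U_{i+1} = Spec ℤ[t]_n[X_{i+1}, X_{i+1}⁻¹]`.  All these rings are subrings of the
ring of Laurent polynomials `ℤ[M]` on the open torus, `M = ℤ f ⊕ ⨁_j ℤ e_j`, `t_j = z^{e_j}`,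
`X_0 = z^f`, and each of them is the monoid algebra of the monoid generated by the exponents of its
generators.  The formal completion along `t = 0` is described by the thickenings of the central
fibre: it has the charts `U_i` with coordinate rings `lim_N 𝒪(U_i)/(t)^N`, glued along the `V_i`
(nonadjacent charts do not meet on the thickenings, since some `t_j` is invertible on their
intersection).
-/

noncomputable section

namespace TateCurve

/-- The character lattice `M = ℤ f ⊕ ⨁_{j ∈ ℤ/n} ℤ e_j` of the open torus; the first component is
the coefficient of `f`. -/
abbrev Lattice (n : ℕ) := ℤ × (ZMod n → ℤ)

/-- `e_j`, the exponent of `t_j`. -/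
def e {n : ℕ} (j : ZMod n) : Lattice n := (0, Pi.single j 1)

/-- The exponent of `X_i`, that is `f + ∑_{0 ≤ j < n} ⌊(j - i)/n⌋ e_j` (see `xExp_zero` and
`xExp_succ`: it is characterized by `X_0 = z^f` and `X_i = t_i X_{i+1}`).  The exponent of
`Y_i = X_i⁻¹` is `-xExp n i`. -/
def xExp (n : ℕ) (i : ℤ) : Lattice n := (1, fun j => ((j.val : ℤ) - i) / (n : ℤ))

/-- The piecewise linear function `φ(t) = t k - k (k + 1)/2` for `k ≤ t ≤ k + 1`, `k ∈ ℤ`. -/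
def phi (t : ℚ) : ℚ := t * ⌊t⌋ - (⌊t⌋ : ℚ) * (⌊t⌋ + 1) / 2

/-- `p ∈ (1/m) ℤ` (for `m ≥ 1`). -/
def InvMul (m : ℕ) (p : ℚ) : Prop := ∃ a : ℤ, (m : ℚ) * p = a

/-- The lattice point `m w_p`, where
`w_p = -p f + ∑_{0 ≤ j < n} n φ((j - p)/n) e_j`, for `p ∈ (1/m) ℤ`.  In this case the coordinates of
`m w_p` are integers, and taking floors does not change them (`mw_fst`, `mw_snd`). -/
def mw (n m : ℕ) (p : ℚ) : Lattice n :=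
  (⌊-((m : ℚ) * p)⌋, fun j => ⌊(m : ℚ) * (n * phi ((j.val - p) / n))⌋)

/-- The lattice points `w_i`, `i ∈ ℤ`: the generator `z_i` of `L` on `U_i` is identified with the
character `z^{w_i}`.  They are characterized by `w_0 = 0` and `z_i = X_{i+1} z_{i+1}`
(`w_zero`, `w_succ`). -/
def w (n : ℕ) (i : ℤ) : Lattice n := mw n 1 i

/-! ### Coordinate rings and their thickenings -/

/-- The exponents of the monomials in `𝒪(U_i)`, generated by those of `t_j`, `X_i`, `Y_{i+1}`. -/
def chartMon (n : ℕ) (i : ℤ) : AddSubmonoid (Lattice n) :=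
  AddSubmonoid.closure (Set.range e ∪ {xExp n i, -xExp n (i + 1)})

/-- The exponents of the monomials in `𝒪(V_i)`, generated by those of `t_j`, `X_i`, `X_i⁻¹`. -/
def overlapMon (n : ℕ) (i : ℤ) : AddSubmonoid (Lattice n) :=
  AddSubmonoid.closure (Set.range e ∪ {xExp n i, -xExp n i})

/-- The ideal generated by all the `t_j` in the ring with monomial exponents `P`. -/
def tIdeal {n : ℕ} (P : AddSubmonoid (Lattice n)) : Ideal (AddMonoidAlgebra ℤ P) :=
  Ideal.span {a | ∃ (y : P) (j : ZMod n), (y : Lattice n) = e j ∧ a = AddMonoidAlgebra.single y 1}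

/-- The quotient by the `N`-th power of the ideal `(t)`: functions on the `N`-th thickening of the
central fibre. -/
def Thick {n : ℕ} (P : AddSubmonoid (Lattice n)) (N : ℕ) : Type :=
  AddMonoidAlgebra ℤ P ⧸ tIdeal P ^ N

instance {n : ℕ} (P : AddSubmonoid (Lattice n)) (N : ℕ) : CommRing (Thick P N) :=
  inferInstanceAs (CommRing (AddMonoidAlgebra ℤ P ⧸ tIdeal P ^ N))

/-- The quotient map. -/
def Thick.mk {n : ℕ} (P : AddSubmonoid (Lattice n)) (N : ℕ) : AddMonoidAlgebra ℤ P →+* Thick P N :=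
  Ideal.Quotient.mk (tIdeal P ^ N)

theorem Thick.mk_surjective {n : ℕ} (P : AddSubmonoid (Lattice n)) (N : ℕ) :
    Function.Surjective (Thick.mk P N) := Ideal.Quotient.mk_surjective

/-- The monomial `z^u` on the `N`-th thickening. -/
def mono {n : ℕ} (P : AddSubmonoid (Lattice n)) (N : ℕ) (u : Lattice n) (hu : u ∈ P) : Thick P N :=
  Thick.mk P N (AddMonoidAlgebra.single (⟨u, hu⟩ : P) 1)

/-- The map of thickenings induced by a map `g` of exponents with `g(e_j) = e_{σ(j)}`. -/
def thickMap {n : ℕ} {P Q : AddSubmonoid (Lattice n)} (g : P →+ Q) (σ : ZMod n → ZMod n)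
    (hg : ∀ (y : P) (j : ZMod n), (y : Lattice n) = e j → (g y : Lattice n) = e (σ j)) (N : ℕ) :
    Thick P N →+* Thick Q N :=
  Ideal.quotientMap (tIdeal Q ^ N) (AddMonoidAlgebra.mapDomainRingHom ℤ g) (by
    rw [← Ideal.map_le_iff_le_comap, Ideal.map_pow]
    apply Ideal.pow_right_mono
    rw [tIdeal, Ideal.map_span, Ideal.span_le]
    rintro _ ⟨_, ⟨y, j, hy, rfl⟩, rfl⟩
    exact Ideal.subset_span ⟨g y, σ j, hg y j hy, by simp⟩)

/-- The map of thickenings induced by an inclusion of monoids of exponents. -/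
def inclMap {n : ℕ} {P Q : AddSubmonoid (Lattice n)} (h : P ≤ Q) (N : ℕ) :
    Thick P N →+* Thick Q N :=
  thickMap (AddSubmonoid.inclusion h) id
    (fun y _ hy => (AddSubmonoid.coe_inclusion h y).trans hy) N

theorem thickMap_mk {n : ℕ} {P Q : AddSubmonoid (Lattice n)} (g : P →+ Q) (σ hg) (N : ℕ)
    (x : AddMonoidAlgebra ℤ P) :
    thickMap g σ hg N (Thick.mk P N x) = Thick.mk Q N (AddMonoidAlgebra.mapDomainRingHom ℤ g x) :=
  rfl

theorem thickMap_mono {n : ℕ} {P Q : AddSubmonoid (Lattice n)} (g : P →+ Q) (σ hg) (N : ℕ)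
    (u : Lattice n) (hu : u ∈ P) :
    thickMap g σ hg N (mono P N u hu) = mono Q N (g ⟨u, hu⟩) (g ⟨u, hu⟩).2 := by
  rw [mono, thickMap_mk]; simp [mono]

theorem thickMap_thickMap {n : ℕ} {P Q R : AddSubmonoid (Lattice n)} (g : P →+ Q) (σ hg)
    (h : Q →+ R) (ρ hh) (k : P →+ R) (κ hk) (hc : ∀ y, h (g y) = k y) (N : ℕ) (x : Thick P N) :
    thickMap h ρ hh N (thickMap g σ hg N x) = thickMap k κ hk N x := by
  obtain ⟨x, rfl⟩ := Thick.mk_surjective P N x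
  have hk' : k = h.comp g := by ext1 y; exact (hc y).symm
  subst hk'
  simp [thickMap_mk, AddMonoidAlgebra.mapDomainRingHom_comp]

/-- Restriction from the `(N+1)`-st to the `N`-th thickening. -/
def lower {n : ℕ} (P : AddSubmonoid (Lattice n)) (N : ℕ) : Thick P (N + 1) →+* Thick P N :=
  Ideal.Quotient.factor (Ideal.pow_le_pow_right N.le_succ)

theorem lower_mk {n : ℕ} (P : AddSubmonoid (Lattice n)) (N : ℕ) (x : AddMonoidAlgebra ℤ P) :
    lower P N (Thick.mk P (N + 1) x) = Thick.mk P N x := rfl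

theorem lower_mono {n : ℕ} (P : AddSubmonoid (Lattice n)) (N : ℕ) (u : Lattice n) (hu : u ∈ P) :
    lower P N (mono P (N + 1) u hu) = mono P N u hu := rfl

theorem mono_mul {n : ℕ} (P : AddSubmonoid (Lattice n)) (N : ℕ) (u v : Lattice n)
    (hu : u ∈ P) (hv : v ∈ P) :
    mono P N u hu * mono P N v hv = mono P N (u + v) (P.add_mem hu hv) := by
  simp only [mono, ← map_mul, AddMonoidAlgebra.single_mul_single, mul_one]; rfl

theorem mono_congr {n : ℕ} (P : AddSubmonoid (Lattice n)) (N : ℕ) {u v : Lattice n}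
    (hu : u ∈ P) (hv : v ∈ P) (h : u = v) : mono P N u hu = mono P N v hv := by
  subst h; rfl

/-- The structure map from `ℤ[t]_n` to the functions on the `N`-th thickening. -/
def tHom {n : ℕ} (P : AddSubmonoid (Lattice n)) (h : ∀ j, e j ∈ P) (N : ℕ) :
    MvPolynomial (ZMod n) ℤ →+* Thick P N :=
  MvPolynomial.eval₂Hom (Int.castRingHom _) fun j => mono P N (e j) (h j)

theorem thickMap_tHom {n : ℕ} {P Q : AddSubmonoid (Lattice n)} (g : P →+ Q) (σ hg)
    (hP : ∀ j, e j ∈ P) (hQ : ∀ j, e j ∈ Q) (N : ℕ) (a : MvPolynomial (ZMod n) ℤ) :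
    thickMap g σ hg N (tHom P hP N a) = tHom Q hQ N (MvPolynomial.rename σ a) := by
  have : (thickMap g σ hg N).comp (tHom P hP N)
      = (tHom Q hQ N).comp (MvPolynomial.rename σ).toRingHom := by
    apply MvPolynomial.ringHom_ext
    · intro r; simp
    · intro j
      simp only [tHom, RingHom.comp_apply, MvPolynomial.coe_eval₂Hom, MvPolynomial.eval₂_X,
        AlgHom.toRingHom_eq_coe, RingHom.coe_coe, MvPolynomial.rename_X, thickMap_mono]
      exact mono_congr _ _ _ _ (hg _ _ rfl)
  exact RingHom.congr_fun this a

theorem lower_tHom {n : ℕ} (P : AddSubmonoid (Lattice n)) (h : ∀ j, e j ∈ P) (N : ℕ)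
    (a : MvPolynomial (ZMod n) ℤ) : lower P N (tHom P h (N + 1) a) = tHom P h N a := by
  have : (lower P N).comp (tHom P h (N + 1)) = tHom P h N := by
    apply MvPolynomial.ringHom_ext
    · intro r; simp
    · intro j; simp [tHom, lower_mono]
  exact RingHom.congr_fun this a

section lattice

variable {n : ℕ}

theorem e_mem_chart (i : ℤ) (j : ZMod n) : e j ∈ chartMon n i :=
  AddSubmonoid.subset_closure (Or.inl ⟨j, rfl⟩)

theorem e_mem_overlap (i : ℤ) (j : ZMod n) : e j ∈ overlapMon n i :=
  AddSubmonoid.subset_closure (Or.inl ⟨j, rfl⟩)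

theorem x_mem_chart (i : ℤ) : xExp n i ∈ chartMon n i :=
  AddSubmonoid.subset_closure (by simp)

theorem y_mem_chart (i : ℤ) : -xExp n (i + 1) ∈ chartMon n i :=
  AddSubmonoid.subset_closure (by simp)

theorem x_mem_overlap (i : ℤ) : xExp n i ∈ overlapMon n i :=
  AddSubmonoid.subset_closure (by simp)

theorem neg_x_mem_overlap (i : ℤ) : -xExp n i ∈ overlapMon n i :=
  AddSubmonoid.subset_closure (by simp)

variable [NeZero n]

/-- `X_0 = z^f`. -/
theorem xExp_zero : xExp n 0 = (1, 0) := by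
  ext j
  · rfl
  · simp only [xExp, sub_zero, Pi.zero_apply]
    exact Int.ediv_eq_zero_of_lt (by positivity) (by exact_mod_cast j.val_lt)

theorem val_cast (i : ℤ) : (((i : ZMod n).val : ℕ) : ℤ) = i % n := ZMod.val_intCast i

/-- `X_i = t_i X_{i+1}`. -/
theorem xExp_succ (i : ℤ) : xExp n i = e (i : ZMod n) + xExp n (i + 1) := by
  have hn : (0 : ℤ) < n := by exact_mod_cast Nat.pos_of_ne_zero (NeZero.ne n)
  ext j
  · simp [xExp, e]
  · simp only [xExp, e, Prod.snd_add, Pi.add_apply, Pi.single_apply]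
    have hj : (j.val : ℤ) < n := by exact_mod_cast j.val_lt
    split_ifs with h
    · have hv : (j.val : ℤ) = i % n := by rw [h, val_cast]
      have h1 : (j.val : ℤ) - i = n * (-(i / n)) := by
        have := Int.emod_add_mul_ediv i n; linarith
      have h2 : (j.val : ℤ) - (i + 1) = (n - 1) + n * (-(i / n) - 1) := by
        rw [← sub_sub, h1]; ring
      have h3 : ((n : ℤ) - 1) / n = 0 := Int.ediv_eq_zero_of_lt (by omega) (by omega)
      rw [h2, h1, Int.add_mul_ediv_left _ _ hn.ne', Int.mul_ediv_cancel_left _ hn.ne', h3]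
      ring
    · have hr0 : 0 ≤ ((j.val : ℤ) - i) % n := Int.emod_nonneg _ hn.ne'
      have hr1 : ((j.val : ℤ) - i) % n < n := Int.emod_lt_of_pos _ hn
      have hd := Int.emod_add_mul_ediv ((j.val : ℤ) - i) n
      have hne : ((j.val : ℤ) - i) % n ≠ 0 := by
        intro h0
        apply h
        have : (((j.val : ℤ) - i : ℤ) : ZMod n) = 0 :=
          (ZMod.intCast_zmod_eq_zero_iff_dvd _ _).2 (Int.dvd_of_emod_eq_zero h0)
        push_cast at this
        rw [ZMod.natCast_zmod_val] at this
        exact sub_eq_zero.1 this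
      have h2 : (j.val : ℤ) - (i + 1)
          = (((j.val : ℤ) - i) % n - 1) + n * (((j.val : ℤ) - i) / n) := by linarith
      have h3 : (((j.val : ℤ) - i) % n - 1) / n = 0 :=
        Int.ediv_eq_zero_of_lt (by omega) (by omega)
      rw [h2, Int.add_mul_ediv_left _ _ hn.ne', h3]
      simp

end lattice

/-! ### The function `φ` and the points `m w_p` -/

/-- The linear pieces of `φ`. -/
def psi (q : ℤ) (t : ℚ) : ℚ := q * t - (q : ℚ) * (q + 1) / 2

theorem int_consec (a : ℤ) : 0 ≤ a * (a + 1) := by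
  rcases le_or_gt 0 a with h | h
  · positivity
  · nlinarith

theorem psi_le_phi (q : ℤ) (t : ℚ) : psi q t ≤ phi t := by
  have h0 : (⌊t⌋ : ℚ) ≤ t := Int.floor_le t
  have h1 : t < ⌊t⌋ + 1 := Int.lt_floor_add_one t
  simp only [psi, phi]
  generalize ⌊t⌋ = k at *
  rcases le_or_gt q k with h | h
  · have hq : (q : ℚ) ≤ k := by exact_mod_cast h
    have := int_consec (k - q - 1)
    have h2 : (0 : ℚ) ≤ ((k : ℚ) - q - 1) * (k - q - 1 + 1) := by exact_mod_cast this
    nlinarith [mul_nonneg (sub_nonneg.2 hq) (sub_nonneg.2 h0)]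
  · have hq : (k : ℚ) + 1 ≤ q := by exact_mod_cast h
    have := int_consec (q - k - 1)
    have h2 : (0 : ℚ) ≤ ((q : ℚ) - k - 1) * (q - k - 1 + 1) := by exact_mod_cast this
    nlinarith [mul_nonneg (sub_nonneg.2 hq) (sub_nonneg.2 h1.le)]

theorem phi_eq_psi (q : ℤ) (t : ℚ) (h0 : (q : ℚ) ≤ t) (h1 : t ≤ q + 1) : phi t = psi q t := by
  rcases h1.lt_or_eq with h | h
  · have : ⌊t⌋ = q := Int.floor_eq_iff.2 ⟨h0, h⟩
    simp only [phi, psi, this]; ring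
  · have : ⌊t⌋ = q + 1 := by rw [h]; exact_mod_cast Int.floor_intCast (q + 1)
    simp only [phi, psi]; rw [this, h]; push_cast; ring

theorem mw_fst {n m : ℕ} {p : ℚ} (hp : InvMul m p) : ((mw n m p).1 : ℚ) = -(m * p) := by
  obtain ⟨a, ha⟩ := hp
  simp only [mw, ha]
  rw [← Int.cast_neg, Int.floor_intCast]

theorem mw_snd {n m : ℕ} [NeZero n] {p : ℚ} (hp : InvMul m p) (j : ZMod n) :
    ((mw n m p).2 j : ℚ) = m * (n * phi ((j.val - p) / n)) := by
  obtain ⟨a, ha⟩ := hp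
  have hn : (n : ℚ) ≠ 0 := by exact_mod_cast NeZero.ne n
  simp only [mw]
  generalize hk : ⌊((j.val : ℚ) - p) / n⌋ = k
  obtain ⟨r, hr⟩ := Int.even_mul_succ_self k
  have hr' : (k : ℚ) * (k + 1) = r + r := by exact_mod_cast hr
  have : (m : ℚ) * (n * phi ((j.val - p) / n)) = ((m * j.val - a) * k - m * n * r : ℤ) := by
    simp only [phi, hk]
    have h2 : (m : ℚ) * (n * ((j.val - p) / n * k - k * (k + 1) / 2))
        = (m * j.val - m * p) * k - m * n * (k * (k + 1) / 2) := by
      field_simp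
    rw [h2, ha, hr']; push_cast; ring
  rw [this, Int.floor_intCast]

theorem invMul_one (i : ℤ) : InvMul 1 i := ⟨i, by simp⟩

theorem w_fst {n : ℕ} (i : ℤ) : (w n i).1 = -i := by
  have := mw_fst (n := n) (invMul_one i)
  simp only [Nat.cast_one, one_mul] at this
  exact_mod_cast this

section lattice2

variable {n : ℕ} [NeZero n]

theorem ediv_bounds (s : ℤ) :
    ((s / n : ℤ) : ℚ) ≤ s / n ∧ ((s : ℚ) + 1) / n ≤ ((s / n : ℤ) : ℚ) + 1 := by
  have hn : (0 : ℤ) < n := by exact_mod_cast Nat.pos_of_ne_zero (NeZero.ne n)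
  have hq : (0 : ℚ) < n := by exact_mod_cast hn
  have h1 : s / n * n ≤ s := Int.ediv_mul_le _ hn.ne'
  have h2 : s < (s / n + 1) * n := Int.lt_ediv_add_one_mul_self s hn
  constructor
  · rw [le_div_iff₀ hq]; exact_mod_cast h1
  · rw [div_le_iff₀ hq]; exact_mod_cast h2

/-- `φ` at `(j - i)/n` is computed by the linear pieces whose slopes occur in `X_i`, `X_{i+1}`. -/
theorem phi_eq_left (i : ℤ) (j : ZMod n) :
    phi (((j.val : ℚ) - i) / n) = psi ((xExp n i).2 j) (((j.val : ℚ) - i) / n) := by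
  obtain ⟨h1, h2⟩ := ediv_bounds (n := n) (j.val - i)
  push_cast at h1 h2
  have hq : (0 : ℚ) < n := by exact_mod_cast Nat.pos_of_ne_zero (NeZero.ne n)
  refine phi_eq_psi _ _ h1 (le_trans ?_ h2)
  gcongr; linarith

theorem phi_eq_right (i : ℤ) (j : ZMod n) :
    phi (((j.val : ℚ) - i) / n) = psi ((xExp n (i + 1)).2 j) (((j.val : ℚ) - i) / n) := by
  obtain ⟨h1, h2⟩ := ediv_bounds (n := n) (j.val - (i + 1))
  push_cast at h1 h2
  have hq : (0 : ℚ) < n := by exact_mod_cast Nat.pos_of_ne_zero (NeZero.ne n)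
  refine phi_eq_psi _ _ (le_trans h1 ?_) (le_trans (le_of_eq ?_) h2)
  · gcongr; linarith
  · congr 1; ring

theorem w_snd (i : ℤ) (j : ZMod n) : ((w n i).2 j : ℚ) = n * phi ((j.val - i) / n) := by
  have := mw_snd (n := n) (invMul_one i) j
  rw [Nat.cast_one, one_mul] at this
  exact this

/-- `w_0 = 0`. -/
theorem w_zero : w n 0 = 0 := by
  ext j
  · simp [w_fst]
  · have h := w_snd (n := n) 0 j
    rw [phi_eq_left, xExp_zero] at h
    simp [psi] at h
    simpa using h

/-- `z_i = X_{i+1} z_{i+1}`. -/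
theorem w_succ (i : ℤ) : w n i = xExp n (i + 1) + w n (i + 1) := by
  ext j
  · simp [w_fst, xExp]
  · have hn : (n : ℚ) ≠ 0 := by exact_mod_cast NeZero.ne n
    have h1 := w_snd (n := n) i j
    have h2 := w_snd (n := n) (i + 1) j
    rw [phi_eq_right] at h1
    rw [phi_eq_left] at h2
    have : ((w n i).2 j : ℚ) = (xExp n (i + 1)).2 j + (w n (i + 1)).2 j := by
      rw [h1, h2]; simp only [psi]; push_cast; field_simp; ring
    exact_mod_cast this

/-- The nonnegative combinations of the `e_j` are exponents of functions on `U_i`. -/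
theorem nat_mem_chart (i : ℤ) (c : ZMod n → ℕ) :
    ((0, fun j => (c j : ℤ)) : Lattice n) ∈ chartMon n i := by
  have : ((0, fun j => (c j : ℤ)) : Lattice n) = ∑ j, c j • e j := by
    ext k
    · simp [e, Prod.fst_sum]
    · simp [e, Prod.snd_sum, Finset.sum_apply, Pi.single_apply]
  rw [this]
  exact sum_mem fun j _ => nsmul_mem (e_mem_chart i j) _

/-- Decomposition of the exponent of `z^{m w_p}` relative to the generator `z_i^m` on `U_i`. -/
theorem mw_decomp {m : ℕ} {p : ℚ} (hp : InvMul m p) (i : ℤ) :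
    ∃ s ∈ chartMon n i, ∃ (c : ZMod n → ℕ) (q : ZMod n → ℤ),
      mw n m p - m • w n i = s + (0, fun j => (c j : ℤ)) ∧
      (∀ j, (c j : ℚ) = m * (n * (phi ((j.val - p) / n) - psi (q j) ((j.val - p) / n)))) ∧
      (q = (xExp n i).2 ∨ q = (xExp n (i + 1)).2) := by
  have hn : (n : ℚ) ≠ 0 := by exact_mod_cast NeZero.ne n
  obtain ⟨D, hD⟩ : ∃ D, D = mw n m p - m • w n i := ⟨_, rfl⟩
  have hD1 : (D.1 : ℚ) = -(m * p) + m * i := by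
    rw [hD]; simp [w_fst, mw_fst hp]
  have hD2 : ∀ j, (D.2 j : ℚ)
      = m * (n * phi ((j.val - p) / n)) - m * (n * phi ((j.val - i) / n)) := by
    intro j; rw [hD]; simp [w_snd, mw_snd hp]
  have key : ∀ (q : ZMod n → ℤ),
      (∀ j, phi (((j.val : ℚ) - i) / n) = psi (q j) (((j.val : ℚ) - i) / n)) →
      ∃ c : ZMod n → ℕ, (∀ j, D.2 j = D.1 * q j + c j) ∧
      (∀ j, (c j : ℚ) = m * (n * (phi ((j.val - p) / n) - psi (q j) ((j.val - p) / n)))) := by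
    intro q hq
    have h0 : ∀ j, ((D.2 j - D.1 * q j : ℤ) : ℚ)
        = m * (n * (phi ((j.val - p) / n) - psi (q j) ((j.val - p) / n))) := by
      intro j
      push_cast
      rw [hD1, hD2, hq]; simp only [psi]; field_simp; ring
    have h1 : ∀ j, 0 ≤ D.2 j - D.1 * q j := by
      intro j
      have := h0 j
      have h2 : (0 : ℚ) ≤ ((D.2 j - D.1 * q j : ℤ) : ℚ) := by
        rw [this]
        have := sub_nonneg.2 (psi_le_phi (q j) ((j.val - p) / n))
        positivity
      exact_mod_cast h2
    refine ⟨fun j => (D.2 j - D.1 * q j).toNat, fun j => ?_, fun j => ?_⟩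
    · rw [Int.toNat_of_nonneg (h1 j)]; ring
    · rw [← h0 j]; exact_mod_cast congrArg (Int.cast : ℤ → ℚ) (Int.toNat_of_nonneg (h1 j))
  rw [← hD]
  rcases le_or_gt 0 D.1 with h | h
  · obtain ⟨c, hc1, hc2⟩ := key (xExp n i).2 (phi_eq_left i)
    refine ⟨D.1.toNat • xExp n i, nsmul_mem (x_mem_chart i) _, c, _, ?_, hc2, Or.inl rfl⟩
    ext j
    · simp [xExp, Int.toNat_of_nonneg h]
    · simp [hc1 j, Int.toNat_of_nonneg h]
  · obtain ⟨c, hc1, hc2⟩ := key (xExp n (i + 1)).2 (phi_eq_right i)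
    obtain ⟨k, hk⟩ : ∃ k : ℕ, D.1 = -(k : ℤ) := ⟨(-D.1).toNat, by omega⟩
    refine ⟨k • -xExp n (i + 1), nsmul_mem (y_mem_chart i) _, c, _, ?_, hc2, Or.inr rfl⟩
    ext j
    · simp [xExp, hk]
    · simp [hc1 j, hk]

/-- `z^{m w_p}` is a section of `L^m` over each `U_i`, for `p ∈ (1/m) ℤ`. -/
theorem mw_mem {m : ℕ} {p : ℚ} (hp : InvMul m p) (i : ℤ) :
    mw n m p - m • w n i ∈ chartMon n i := by
  obtain ⟨s, hs, c, q, h, -⟩ := mw_decomp (n := n) hp i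
  rw [h]
  exact add_mem hs (nat_mem_chart i c)

end lattice2

/-! ### The shift `τ` -/

section shift

variable {n : ℕ}

/-- The linear map `τ_M` on exponents: `e_j ↦ e_{j-1}`, `f ↦ f + e_{-1}`. -/
def tauM (n : ℕ) : Lattice n →+ Lattice n where
  toFun u := (u.1, fun j => u.2 (j + 1) + if j = -1 then u.1 else 0)
  map_zero' := by ext <;> simp
  map_add' u v := by
    ext j
    · simp
    · by_cases h : j = -1
      · simp [h]; ring
      · simp [h]

/-- The map of monoids of exponents given by `τ_M`. -/
def tauRes {P Q : AddSubmonoid (Lattice n)} (h : ∀ u ∈ P, tauM n u ∈ Q) : P →+ Q where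
  toFun u := ⟨tauM n u.1, h u.1 u.2⟩
  map_zero' := Subtype.ext (map_zero (tauM n))
  map_add' u v := Subtype.ext (map_add (tauM n) u.1 v.1)

theorem tauRes_coe {P Q : AddSubmonoid (Lattice n)} (h : ∀ u ∈ P, tauM n u ∈ Q) (y : P) :
    (tauRes h y : Lattice n) = tauM n y.1 := rfl

theorem thickMap_tauRes {P P' Q : AddSubmonoid (Lattice n)} (σ : ZMod n → ZMod n) (hP : P ≤ P')
    (h : ∀ u ∈ P', tauM n u ∈ Q) (hσ) (h' : ∀ u ∈ P, tauM n u ∈ Q) (hσ') (N : ℕ) (x : Thick P N) :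
    thickMap (tauRes h) σ hσ N (inclMap hP N x) = thickMap (tauRes h') σ hσ' N x := by
  unfold inclMap
  exact thickMap_thickMap _ _ _ _ _ _ _ _ _
    (fun y => Subtype.ext (by rw [tauRes_coe, tauRes_coe, AddSubmonoid.coe_inclusion])) _ _

theorem inclMap_tauRes {P Q Q' : AddSubmonoid (Lattice n)} (σ : ZMod n → ZMod n) (hQ : Q ≤ Q')
    (h : ∀ u ∈ P, tauM n u ∈ Q) (hσ) (h' : ∀ u ∈ P, tauM n u ∈ Q') (hσ') (N : ℕ) (x : Thick P N) :
    inclMap hQ N (thickMap (tauRes h) σ hσ N x) = thickMap (tauRes h') σ hσ' N x := by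
  unfold inclMap
  exact thickMap_thickMap _ _ _ _ _ _ _ _ _
    (fun y => Subtype.ext (by rw [AddSubmonoid.coe_inclusion, tauRes_coe, tauRes_coe])) _ _

theorem tauM_e (j : ZMod n) : tauM n (e j) = e (j - 1) := by
  ext k
  · simp [tauM, e]
  · simp [tauM, e, Pi.single_apply, eq_sub_iff_add_eq]

theorem tauRes_e {P Q : AddSubmonoid (Lattice n)} (h : ∀ u ∈ P, tauM n u ∈ Q) (y : P) (j : ZMod n)
    (hy : (y : Lattice n) = e j) : (tauRes h y : Lattice n) = e (j - 1) :=
  (congrArg (tauM n) hy).trans (tauM_e j)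

variable [NeZero n]

theorem val_neg_one : ((-1 : ZMod n).val : ℤ) + 1 = n := by
  obtain ⟨k, rfl⟩ := Nat.exists_eq_succ_of_ne_zero (NeZero.ne n)
  rw [ZMod.val_neg_one k]; simp

theorem val_succ (j : ZMod n) :
    ((j + 1).val : ℤ) = j.val + 1 - if j = -1 then (n : ℤ) else 0 := by
  have hn : 0 < n := Nat.pos_of_ne_zero (NeZero.ne n)
  split_ifs with h
  · subst h
    rw [val_neg_one]; simp
  · have h2 : j.val ≠ n - 1 := by
      intro h3
      apply h
      have h4 : ((j.val + 1 : ℕ) : ZMod n) = 0 := by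
        rw [h3, Nat.sub_add_cancel hn]; exact ZMod.natCast_self n
      push_cast at h4
      rw [ZMod.natCast_zmod_val] at h4
      exact eq_neg_of_add_eq_zero_left h4
    have h5 := j.val_lt
    have h6 : j + 1 = ((j.val + 1 : ℕ) : ZMod n) := by
      push_cast; rw [ZMod.natCast_zmod_val]
    rw [h6, ZMod.val_natCast, Nat.mod_eq_of_lt (by omega)]
    simp

/-- `τ^* X_{i+1} = X_i`. -/
theorem tauM_x (i : ℤ) : tauM n (xExp n (i + 1)) = xExp n i := by
  have hn : (n : ℤ) ≠ 0 := by exact_mod_cast NeZero.ne n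
  ext j
  · rfl
  · simp only [tauM, xExp, AddMonoidHom.coe_mk, ZeroHom.coe_mk, val_succ]
    split_ifs
    · rw [show (j.val : ℤ) + 1 - n - (i + 1) = (j.val - i) + n * (-1) by ring,
        Int.add_mul_ediv_left _ _ hn]
      ring
    · rw [add_zero]; congr 1; ring

theorem phi_add_one (t : ℚ) : phi (t + 1) = phi t + t := by
  simp only [phi, Int.floor_add_one]; push_cast; ring

/-- The affine map `τ` underlying the action on `L^m` sends `m w_p` to `m w_{p-1}`. -/
theorem tauM_mw {m : ℕ} {p : ℚ} (hp : InvMul m p) (hp' : InvMul m (p - 1)) :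
    tauM n (mw n m p) + ((m : ℤ), 0) = mw n m (p - 1) := by
  have hn : (n : ℚ) ≠ 0 := by exact_mod_cast NeZero.ne n
  ext j
  · have : ((tauM n (mw n m p) + ((m : ℤ), 0)).1 : ℚ) = (mw n m (p - 1)).1 := by
      simp only [tauM, AddMonoidHom.coe_mk, ZeroHom.coe_mk, Prod.fst_add]
      push_cast
      rw [mw_fst hp, mw_fst hp']; ring
    exact_mod_cast this
  · have : ((tauM n (mw n m p) + ((m : ℤ), 0)).2 j : ℚ) = (mw n m (p - 1)).2 j := by
      simp only [tauM, AddMonoidHom.coe_mk, ZeroHom.coe_mk, Prod.snd_add, Pi.add_apply,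
        Pi.zero_apply, add_zero]
      have hv : (((j + 1).val : ℕ) : ℚ) = j.val + 1 - if j = -1 then (n : ℚ) else 0 := by
        have := congrArg (Int.cast : ℤ → ℚ) (val_succ j)
        push_cast at this
        exact this
      push_cast
      rw [mw_snd hp, mw_snd hp', hv]
      split_ifs with hj
      · rw [mw_fst hp]
        have h1 : ((j.val : ℚ) - (p - 1)) / n = ((j.val : ℚ) + 1 - n - p) / n + 1 := by
          field_simp; ring
        rw [h1, phi_add_one]
        have h2 : ((j.val : ℚ) + 1 - n) = 0 := by
          rw [hj]
          have := congrArg (Int.cast : ℤ → ℚ) (val_neg_one (n := n))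
          push_cast at this
          linarith
        rw [h2]; field_simp; ring
      · rw [sub_zero, add_zero]
        congr 4; ring
    exact_mod_cast this

theorem tauM_chart (i : ℤ) : ∀ u ∈ chartMon n (i + 1), tauM n u ∈ chartMon n i := by
  intro u hu
  have : chartMon n (i + 1) ≤ (chartMon n i).comap (tauM n) := by
    refine AddSubmonoid.closure_le.2 ?_
    rintro _ (⟨j, rfl⟩ | rfl | rfl)
    · simpa [tauM_e] using e_mem_chart i _
    · simpa [tauM_x] using x_mem_chart i
    · simpa [tauM_x] using y_mem_chart i
  exact this hu

theorem tauM_overlap (i : ℤ) : ∀ u ∈ overlapMon n (i + 1), tauM n u ∈ overlapMon n i := by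
  intro u hu
  have : overlapMon n (i + 1) ≤ (overlapMon n i).comap (tauM n) := by
    refine AddSubmonoid.closure_le.2 ?_
    rintro _ (⟨j, rfl⟩ | rfl | rfl)
    · simpa [tauM_e] using e_mem_overlap i _
    · simpa [tauM_x] using x_mem_overlap i
    · simpa [tauM_x] using neg_x_mem_overlap i
  exact this hu

theorem chart_le_overlap_right (i : ℤ) : chartMon n i ≤ overlapMon n (i + 1) := by
  refine AddSubmonoid.closure_le.2 ?_
  rintro _ (⟨j, rfl⟩ | rfl | rfl)
  · exact e_mem_overlap _ _
  · rw [xExp_succ]; exact add_mem (e_mem_overlap _ _) (x_mem_overlap _)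
  · exact neg_x_mem_overlap _

theorem chart_le_overlap_left (i : ℤ) : chartMon n i ≤ overlapMon n i := by
  refine AddSubmonoid.closure_le.2 ?_
  rintro _ (⟨j, rfl⟩ | rfl | rfl)
  · exact e_mem_overlap _ _
  · exact x_mem_overlap _
  · have : -xExp n (i + 1) = e (i : ZMod n) + -xExp n i := by rw [xExp_succ i]; abel
    rw [this]; exact add_mem (e_mem_overlap _ _) (neg_x_mem_overlap _)

end shift

/-! ### Sections of `L^m` on the formal completion, and on the quotient by `nℤ` -/

/-- The ring `ℤ[t]_n`, a dense subring of the base ring `ℤ[[t]]_n` of the formal completion; it contains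
all the coefficients of the product formula. -/
abbrev Base (n : ℕ) := MvPolynomial (ZMod n) ℤ

/-- Functions on the `N`-th thickening of `U_i`. -/
abbrev Chart (n : ℕ) (i : ℤ) (N : ℕ) := Thick (chartMon n i) N

/-- Functions on the `N`-th thickening of `V_i`. -/
abbrev Overlap (n : ℕ) (i : ℤ) (N : ℕ) := Thick (overlapMon n i) N

instance (n : ℕ) (i : ℤ) (N : ℕ) : Algebra (Base n) (Chart n i N) :=
  (tHom (chartMon n i) (e_mem_chart i) N).toAlgebra

theorem smul_def' {n : ℕ} (i : ℤ) (N : ℕ) (a : Base n) (x : Chart n i N) :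
    a • x = tHom (chartMon n i) (e_mem_chart i) N a * x := Algebra.smul_def _ _

section sections

variable {n : ℕ} [NeZero n]

/-- Restriction of functions from `U_i` to `V_i = U_{i-1} ∩ U_i`. -/
def resLeft (i : ℤ) (N : ℕ) : Chart n i N →+* Overlap n i N :=
  inclMap (chart_le_overlap_left i) N

/-- Restriction of functions from `U_i` to `V_{i+1} = U_i ∩ U_{i+1}`. -/
def resRight (i : ℤ) (N : ℕ) : Chart n i N →+* Overlap n (i + 1) N :=
  inclMap (chart_le_overlap_right i) N

/-- `τ^*` from functions on `U_{i+1}` to functions on `U_i`. -/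
def tauChart (i : ℤ) (N : ℕ) : Chart n (i + 1) N →+* Chart n i N :=
  thickMap (tauRes (tauM_chart i)) (· - 1) (tauRes_e _) N

/-- `τ^*` from functions on `V_{i+1}` to functions on `V_i`. -/
def tauOverlap (i : ℤ) (N : ℕ) : Overlap n (i + 1) N →+* Overlap n i N :=
  thickMap (tauRes (tauM_overlap i)) (· - 1) (tauRes_e _) N

/-- The invertible function `X_{i+1}^m` on `V_{i+1}`. -/
def xPow (m : ℕ) (i : ℤ) (N : ℕ) : Overlap n (i + 1) N :=
  mono _ N (m • xExp n (i + 1)) (nsmul_mem (x_mem_overlap _) m)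

theorem resRight_tHom (i : ℤ) (N : ℕ) (a : Base n) :
    resRight i N (tHom (chartMon n i) (e_mem_chart i) N a)
      = tHom (overlapMon n (i + 1)) (e_mem_overlap _) N a := by
  rw [resRight, inclMap, thickMap_tHom _ _ _ _ (e_mem_overlap _), MvPolynomial.rename_id_apply]

theorem resLeft_tHom (i : ℤ) (N : ℕ) (a : Base n) :
    resLeft i N (tHom (chartMon n i) (e_mem_chart i) N a)
      = tHom (overlapMon n i) (e_mem_overlap _) N a := by
  rw [resLeft, inclMap, thickMap_tHom _ _ _ _ (e_mem_overlap _), MvPolynomial.rename_id_apply]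

theorem tauChart_tHom (i : ℤ) (N : ℕ) (a : Base n) :
    tauChart i N (tHom (chartMon n (i + 1)) (e_mem_chart _) N a)
      = tHom (chartMon n i) (e_mem_chart _) N (MvPolynomial.rename (· - 1) a) := by
  rw [tauChart, thickMap_tHom _ _ _ _ (e_mem_chart _)]

theorem lower_tauChart (i : ℤ) (N : ℕ) (x : Chart n (i + 1) (N + 1)) :
    lower _ N (tauChart i (N + 1) x) = tauChart i N (lower _ N x) := by
  obtain ⟨x, rfl⟩ := Thick.mk_surjective _ _ x
  rw [tauChart, tauChart, thickMap_mk, lower_mk, lower_mk, thickMap_mk]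

theorem tauOverlap_resRight (i : ℤ) (N : ℕ) (x : Chart n (i + 1) N) :
    tauOverlap (i + 1) N (resRight (i + 1) N x) = resRight i N (tauChart i N x) := by
  have h : ∀ u ∈ chartMon n (i + 1), tauM n u ∈ overlapMon n (i + 1) :=
    fun u hu => chart_le_overlap_right i (tauM_chart i u hu)
  unfold tauOverlap resRight tauChart
  rw [thickMap_tauRes _ _ _ _ h (tauRes_e _), inclMap_tauRes _ _ _ _ h (tauRes_e _)]

theorem tauOverlap_resLeft (i : ℤ) (N : ℕ) (x : Chart n (i + 1) N) :
    tauOverlap i N (resLeft (i + 1) N x) = resLeft i N (tauChart i N x) := by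
  have h : ∀ u ∈ chartMon n (i + 1), tauM n u ∈ overlapMon n i :=
    fun u hu => chart_le_overlap_left i (tauM_chart i u hu)
  unfold tauOverlap resLeft tauChart
  rw [thickMap_tauRes _ _ _ _ h (tauRes_e _), inclMap_tauRes _ _ _ _ h (tauRes_e _)]

variable (n)

/-- `H^0(𝒯̂, L^m)`: sections of `L^m` on the formal completion `𝒯̂` of `𝒯_{∞,n}` along `t = 0`.
Such a section `s` consists of the coefficients `s_i` of the generators `z_i^m` on the charts `U_i`,
modulo all powers `(t)^N`, compatible with change of `N` and with the transition rule
`z_i = X_{i+1} z_{i+1}` on `V_{i+1} = U_i ∩ U_{i+1}`. -/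
def FormalSections (m : ℕ) : Submodule (Base n) (∀ (N : ℕ) (i : ℤ), Chart n i N) where
  carrier := {s | (∀ N i, lower _ N (s (N + 1) i) = s N i) ∧
    ∀ N i, resRight i N (s N i) * xPow m i N = resLeft (i + 1) N (s N (i + 1))}
  zero_mem' := by simp
  add_mem' := by
    rintro a b ⟨ha, ha'⟩ ⟨hb, hb'⟩
    exact ⟨fun N i => by simp [ha, hb], fun N i => by simp [add_mul, ha', hb']⟩
  smul_mem' := by
    rintro c a ⟨ha, ha'⟩
    refine ⟨fun N i => ?_, fun N i => ?_⟩
    · simp only [Pi.smul_apply, smul_def', map_mul, lower_tHom, ha]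
    · simp only [Pi.smul_apply, smul_def', map_mul, resRight_tHom, resLeft_tHom, mul_assoc, ha']

/-- The action of the generator `τ` of `ℤ` on sections of `L^m`, lifting the automorphism `τ` of
`𝒯_{∞,n}` (`τ^* t_j = t_{j-1}`, `τ^* X_i = X_{i-1}`) by `z_{i+1} ↦ z_i`. -/
def tau (m : ℕ) : FormalSections n m →+ FormalSections n m where
  toFun s := ⟨fun N i => tauChart i N (s.1 N (i + 1)),
    ⟨fun N i => by rw [lower_tauChart, s.2.1],
    fun N i => by
      rw [← tauOverlap_resLeft, ← s.2.2 N (i + 1), map_mul, tauOverlap_resRight]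
      congr 1
      rw [xPow, xPow, tauOverlap, thickMap_mono]
      refine mono_congr _ _ _ _ ?_
      rw [tauRes_coe, map_nsmul, tauM_x]⟩⟩
  map_zero' := by ext N i; simp
  map_add' a b := by ext N i; simp

/-- `H^0(T_n, L^m) = H^0(𝒯̂, L^m)^{nℤ}`: sections of `L^m` on the `n`-Tate curve.  Since `T_n` is the
algebraization of the formal curve `𝒯̂/nℤ`, these are the sections on `𝒯̂` which are invariant under
the subgroup `nℤ ⊆ ℤ`, generated by `τ^n`. -/
def TateSections (m : ℕ) : Submodule (Base n) (FormalSections n m) where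
  carrier := {s | (tau n m)^[n] s = s}
  zero_mem' := by simp [iterate_map_zero]
  add_mem' := by
    intro a b ha hb
    simp only [Set.mem_ofPred_eq, iterate_map_add] at *
    rw [ha, hb]
  smul_mem' := by
    intro c a ha
    have h : ∀ k : ℕ, (tau n m)^[k] (c • a)
        = (MvPolynomial.rename (fun j : ZMod n => j - k) c : Base n) • (tau n m)^[k] a := by
      intro k
      induction k with
      | zero => simp [← Function.id_def]
      | succ k ih =>
        rw [Function.iterate_succ_apply', ih, Function.iterate_succ_apply']
        ext N i
        simp only [tau, AddMonoidHom.coe_mk, ZeroHom.coe_mk, Submodule.coe_smul, Pi.smul_apply,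
          smul_def', map_mul, tauChart_tHom, MvPolynomial.rename_rename]
        congr 4
        ext j; simp only [Function.comp_apply]; push_cast; ring
    have := h n
    simp only [CharP.cast_eq_zero, sub_zero, ← Function.id_def, MvPolynomial.rename_id_apply] at this
    simp only [Set.mem_ofPred_eq] at *
    rw [this, ha]

/-- The topology on `H^0(𝒯̂, L^m)` in which a net converges if it is eventually constant on every
chart of every finite order thickening of the central fibre.  On the subspace `TateSections n m` it
induces the `(t)`-adic topology. -/
instance (m : ℕ) : TopologicalSpace (FormalSections n m) :=
  ⨅ (N : ℕ) (i : ℤ), TopologicalSpace.induced (fun s => s.1 N i) ⊥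

instance (m : ℕ) : T2Space (FormalSections n m) where
  t2 x y hxy := by
    obtain ⟨N, i, h⟩ : ∃ N i, x.1 N i ≠ y.1 N i := by
      by_contra! h
      exact hxy (Subtype.ext (funext fun N => funext fun i => h N i))
    have ho : ∀ a : Chart n i N, IsOpen {s : FormalSections n m | s.1 N i = a} := fun a =>
      (iInf₂_le (f := fun (N : ℕ) (i : ℤ) =>
        TopologicalSpace.induced (fun s : FormalSections n m => s.1 N i) ⊥) N i) _
        ⟨{a}, trivial, rfl⟩
    refine ⟨_, _, ho (x.1 N i), ho (y.1 N i), rfl, rfl, ?_⟩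
    rw [Set.disjoint_left]
    intro s h1 h2
    exact h (h1.symm.trans h2)

variable {n}

theorem tau_apply {m : ℕ} (s : FormalSections n m) (N : ℕ) (i : ℤ) :
    (tau n m s).1 N i = tauChart i N (s.1 N (i + 1)) := rfl

/-- The product `L^{m₁} ⊗ L^{m₂} → L^{m₁ + m₂}` on sections. -/
def mulSec {m₁ m₂ : ℕ} (s : FormalSections n m₁) (s' : FormalSections n m₂) :
    FormalSections n (m₁ + m₂) :=
  ⟨fun N i => s.1 N i * s'.1 N i, ⟨fun N i => by rw [map_mul, s.2.1, s'.2.1], fun N i => by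
    have : xPow (n := n) (m₁ + m₂) i N = xPow m₁ i N * xPow m₂ i N := by
      rw [xPow, xPow, xPow, mono_mul]
      exact mono_congr _ _ _ _ (add_smul _ _ _)
    rw [map_mul, map_mul, ← s.2.2, ← s'.2.2, this]; ring⟩⟩

theorem tau_mul {m₁ m₂ : ℕ} (s : FormalSections n m₁) (s' : FormalSections n m₂) :
    tau n _ (mulSec s s') = mulSec (tau n _ s) (tau n _ s') := by
  ext N i; simp [tau, mulSec]

instance (m₁ m₂ : ℕ) : HMul (TateSections n m₁) (TateSections n m₂) (TateSections n (m₁ + m₂)) where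
  hMul s s' := ⟨mulSec s.1 s'.1, by
    have h : ∀ k : ℕ, (tau n _)^[k] (mulSec s.1 s'.1)
        = mulSec ((tau n _)^[k] s.1) ((tau n _)^[k] s'.1) := by
      intro k
      induction k with
      | zero => rfl
      | succ k ih => simp only [Function.iterate_succ_apply', ih, tau_mul]
    have hs : (tau n m₁)^[n] s.1 = s.1 := s.2
    have hs' : (tau n m₂)^[n] s'.1 = s'.1 := s'.2
    change (tau n _)^[n] (mulSec s.1 s'.1) = _
    rw [h n, hs, hs']⟩

end sections

/-! ### Theta functions -/

theorem InvMul.neg_add {n m : ℕ} {p : ℚ} (hp : InvMul m p) (k : ℤ) :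
    InvMul m (-p + k * n) := by
  obtain ⟨a, ha⟩ := hp
  exact ⟨-a + m * (k * n), by push_cast; rw [← ha]; ring⟩

section theta

variable {n : ℕ} [NeZero n]

theorem InvMul.sub_one {m : ℕ} {p : ℚ} (hp : InvMul m p) : InvMul m (p - 1) := by
  obtain ⟨a, ha⟩ := hp
  exact ⟨a - m, by push_cast; rw [← ha]; ring⟩

theorem InvMul.add_one {m : ℕ} {p : ℚ} (hp : InvMul m p) : InvMul m (p + 1) := by
  obtain ⟨a, ha⟩ := hp
  exact ⟨a + m, by push_cast; rw [← ha]; ring⟩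

variable (n)

/-- The section `z^{m w_p}` of `L^m`, for `p ∈ (1/m) ℤ`; on `U_i` it equals
`z^{m w_p - m w_i} z_i^m`. -/
def zSec (m : ℕ) (p : ℚ) (hp : InvMul m p) : FormalSections n m :=
  ⟨fun N i => mono _ N (mw n m p - m • w n i) (mw_mem hp i),
    ⟨fun N i => lower_mono _ _ _ _, fun N i => by
      rw [xPow, resRight, resLeft, inclMap, inclMap, thickMap_mono, thickMap_mono, mono_mul]
      refine mono_congr _ _ _ _ ?_
      simp only [AddSubmonoid.coe_inclusion]
      rw [w_succ i, smul_add]; abel⟩⟩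

variable {n}

theorem tau_zSec {m : ℕ} {p : ℚ} (hp : InvMul m p) :
    tau n m (zSec n m p hp) = zSec n m (p - 1) hp.sub_one := by
  ext N i
  rw [tau_apply]
  simp only [zSec, tauChart, thickMap_mono]
  refine mono_congr _ _ _ _ ?_
  rw [tauRes_coe, map_sub, map_nsmul]
  have h1 := tauM_mw (n := n) hp hp.sub_one
  have h2 : tauM n (w n (i + 1)) + ((1 : ℤ), 0) = w n i := by
    have := tauM_mw (n := n) (invMul_one (i + 1)) (invMul_one (i + 1)).sub_one
    simpa [w] using this
  rw [← h1, ← h2, smul_add]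
  ext <;> simp

theorem mono_eq_zero {i : ℤ} {N : ℕ} {s : Lattice n} (hs : s ∈ chartMon n i) (c : ZMod n → ℕ)
    (j : ZMod n) (hc : N ≤ c j) (hu : s + (0, fun j => (c j : ℤ)) ∈ chartMon n i) :
    mono (chartMon n i) N (s + (0, fun j => (c j : ℤ))) hu = 0 := by
  have hd : ((0, fun j => (c j : ℤ)) : Lattice n)
      = N • e j + (0, fun k => ((c k - if k = j then N else 0 : ℕ) : ℤ)) := by
    ext k
    · simp [e]
    · by_cases hk : k = j
      · subst hk; simp [e, hc]
      · simp [e, hk]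
  have h1 : N • e j ∈ chartMon n i := nsmul_mem (e_mem_chart i j) N
  have h2 := add_mem hs (nat_mem_chart i fun k => c k - if k = j then N else 0)
  have h3 : mono (chartMon n i) N (N • e j) h1 = 0 := by
    refine Ideal.Quotient.eq_zero_iff_mem.2 ?_
    have h4 : (AddMonoidAlgebra.single (⟨N • e j, h1⟩ : chartMon n i) 1 :
        AddMonoidAlgebra ℤ (chartMon n i))
        = (AddMonoidAlgebra.single (⟨e j, e_mem_chart i j⟩ : chartMon n i) 1) ^ N := by
      rw [AddMonoidAlgebra.single_pow, one_pow]; rfl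
    rw [h4]
    have h5 : (AddMonoidAlgebra.single (⟨e j, e_mem_chart i j⟩ : chartMon n i) 1 :
        AddMonoidAlgebra ℤ (chartMon n i)) ∈ tIdeal (chartMon n i) :=
      Ideal.subset_span ⟨_, j, rfl, rfl⟩
    exact Ideal.pow_mem_pow h5 N
  rw [← zero_mul (mono (chartMon n i) N _ h2), ← h3, mono_mul]
  refine mono_congr _ _ _ _ ?_
  rw [hd]; abel

/-- On every finite order thickening of a chart, all but finitely many terms of the series defining
a theta function vanish. -/
theorem finite_support {m : ℕ} (hm : 1 ≤ m) {p : ℚ} (hp : InvMul m p) (N : ℕ) (i : ℤ) :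
    (Function.support fun k : ℤ => (zSec n m (-p + k * n) (hp.neg_add k)).1 N i).Finite := by
  have hn0 : (0 : ℚ) < n := by exact_mod_cast Nat.pos_of_ne_zero (NeZero.ne n)
  have hn1 : (1 : ℚ) ≤ n := by exact_mod_cast Nat.pos_of_ne_zero (NeZero.ne n)
  have hm1 : (1 : ℚ) ≤ m := by exact_mod_cast hm
  have hfin : ∀ q : ℤ, {k : ℤ | p / n - q - 1 - N < k ∧ (k : ℚ) < p / n - q + N}.Finite := by
    intro q
    refine (Set.finite_Icc ⌊p / n - q - 1 - N⌋ ⌈p / n - q + N⌉).subset ?_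
    rintro k ⟨h1, h2⟩
    constructor
    · have := (Int.floor_le (p / n - q - 1 - N)).trans h1.le
      exact_mod_cast this
    · have := h2.le.trans (Int.le_ceil (p / n - q + N))
      exact_mod_cast this
  refine ((hfin ((xExp n i).2 0)).union (hfin ((xExp n (i + 1)).2 0))).subset ?_
  intro k hk
  obtain ⟨s, hs, c, q, h, hc, hq⟩ := mw_decomp (n := n) (hp.neg_add (n := n) k) i
  have hlt : c 0 < N := by
    by_contra hcN
    apply hk
    have h0 := mono_eq_zero hs c 0 (not_lt.1 hcN) (h ▸ mw_mem (hp.neg_add k) i)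
    exact (mono_congr _ _ _ _ h).trans h0
  have hlt' : (c 0 : ℚ) < N := by exact_mod_cast hlt
  rw [hc 0] at hlt'
  have ht : (((0 : ZMod n).val : ℚ) - (-p + k * n)) / n = p / n - k := by
    rw [ZMod.val_zero]; field_simp; push_cast; ring
  rw [ht] at hlt'
  have hmn : (1 : ℚ) ≤ m * n := one_le_mul_of_one_le_of_one_le hm1 hn1
  have hd : phi (p / n - k) - psi (q 0) (p / n - k) < N := by
    have h0 := sub_nonneg.2 (psi_le_phi (q 0) (p / n - k))
    nlinarith
  have ha := psi_le_phi (q 0 + 1) (p / n - k)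
  have hb := psi_le_phi (q 0 - 1) (p / n - k)
  have hmem : p / n - q 0 - 1 - N < k ∧ (k : ℚ) < p / n - q 0 + N := by
    simp only [psi] at *
    push_cast at *
    constructor <;> nlinarith
  rcases hq with rfl | rfl
  · exact Or.inl hmem
  · exact Or.inr hmem

variable (n) in
/-- The series `∑_{k ∈ ℤ} z^{m w_{-p + kn}}` as a section of `L^m` over `𝒯̂`; the sum is finite on
every finite order thickening of a chart (`finite_support`). -/
def formalTheta (m : ℕ) (hm : 1 ≤ m) (p : ℚ) (hp : InvMul m p) : FormalSections n m :=
  ⟨fun N i => ∑ᶠ k : ℤ, (zSec n m (-p + k * n) (hp.neg_add k)).1 N i, ⟨fun N i => by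
    refine ((lower (chartMon n i) N).toAddMonoidHom.map_finsum
      (finite_support hm hp (N + 1) i)).trans ?_
    exact finsum_congr fun k => (zSec n m (-p + k * n) (hp.neg_add k)).2.1 N i, fun N i => by
    have hf := finite_support (n := n) hm hp N i
    have h1 := (resRight (n := n) i N).toAddMonoidHom.map_finsum hf
    have h2 := (resLeft (n := n) (i + 1) N).toAddMonoidHom.map_finsum
      (finite_support hm hp N (i + 1))
    refine Eq.trans ?_ h2.symm
    refine (congrArg (· * xPow (n := n) m i N) h1).trans ?_
    refine (finsum_mul' _ _ (hf.subset fun k hk h0 => hk ?_)).trans ?_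
    · exact (congrArg (resRight (n := n) i N) h0).trans (map_zero _)
    · exact finsum_congr fun k => (zSec n m (-p + k * n) (hp.neg_add k)).2.2 N i⟩⟩

theorem tau_formalTheta {m : ℕ} (hm : 1 ≤ m) {p : ℚ} (hp : InvMul m p) :
    tau n m (formalTheta n m hm p hp) = formalTheta n m hm (p + 1) hp.add_one := by
  ext N i
  rw [tau_apply]
  refine ((tauChart (n := n) i N).toAddMonoidHom.map_finsum
    (finite_support hm hp N (i + 1))).trans ?_
  refine finsum_congr fun k => ?_
  have h : tau n m (zSec n m (-p + k * n) (hp.neg_add k))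
      = zSec n m (-(p + 1) + k * n) (hp.add_one.neg_add k) := by
    rw [tau_zSec]; congr 1; ring
  rw [← h]; rfl

theorem formalTheta_congr {m : ℕ} (hm : 1 ≤ m) {p q : ℚ} (hp : InvMul m p) (hq : InvMul m q)
    (h : p = q) : formalTheta n m hm p hp = formalTheta n m hm q hq := by
  subst h; rfl

theorem formalTheta_add {m : ℕ} (hm : 1 ≤ m) {p : ℚ} (hp : InvMul m p) (hq : InvMul m (p + n)) :
    formalTheta n m hm (p + n) hq = formalTheta n m hm p hp := by
  ext N i
  refine (finsum_comp_equiv (Equiv.addRight (1 : ℤ))).symm.trans ?_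
  refine finsum_congr fun k => ?_
  have : ∀ q (hq : InvMul m q), q = -p + k * n →
      zSec n m q hq = zSec n m (-p + k * n) (hp.neg_add k) := by
    rintro _ _ rfl; rfl
  rw [this]
  simp only [Equiv.coe_addRight]; push_cast; ring

variable (n)

/-- The theta function `θ_{m,p} = ∑_{k ∈ ℤ} z^{m w_{-p + kn}}`, for `m ≥ 1` and `p ∈ (1/m) ℤ`, as a
section of `L^m` on the `n`-Tate curve. -/
def theta (m : ℕ) (hm : 1 ≤ m) (p : ℚ) (hp : InvMul m p) : TateSections n m :=
  ⟨formalTheta n m hm p hp, by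
    have h : ∀ k : ℕ, ∃ hk : InvMul m (p + k), (tau n m)^[k] (formalTheta n m hm p hp)
        = formalTheta n m hm (p + k) hk := by
      intro k
      induction k with
      | zero => exact ⟨by simpa using hp, formalTheta_congr _ _ _ (by simp)⟩
      | succ k ih =>
        obtain ⟨hk, h⟩ := ih
        have e1 : p + k + 1 = p + (k + 1 : ℕ) := by push_cast; ring
        refine ⟨e1 ▸ hk.add_one, ?_⟩
        rw [Function.iterate_succ_apply', h, tau_formalTheta]
        exact formalTheta_congr _ _ _ e1
    obtain ⟨hk, h⟩ := h n
    change (tau n m)^[n] _ = _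
    rw [h, formalTheta_add hm hp]⟩

end theta

/-! ### The product formula: weights -/

/-- `E(a, b) = (m₁ a + m₂ b)/(m₁ + m₂)`. -/
def E (m₁ m₂ : ℕ) (a b : ℚ) : ℚ := (m₁ * a + m₂ * b) / (m₁ + m₂)

/-- `λ(a, b) = m₁ φ(a) + m₂ φ(b) - (m₁ + m₂) φ(E(a, b))`. -/
def lam (m₁ m₂ : ℕ) (a b : ℚ) : ℚ :=
  m₁ * phi a + m₂ * phi b - (m₁ + m₂) * phi (E m₁ m₂ a b)

theorem invMul_E {m₁ m₂ : ℕ} {p₁ p₂ : ℚ} (n : ℕ) (h₁ : InvMul m₁ p₁) (h₂ : InvMul m₂ p₂) (k : ℤ) :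
    InvMul (m₁ + m₂) (E m₁ m₂ p₁ (p₂ + k * n)) := by
  obtain ⟨a, ha⟩ := h₁
  obtain ⟨b, hb⟩ := h₂
  rcases Nat.eq_zero_or_pos (m₁ + m₂) with h | h
  · exact ⟨0, by rw [h]; simp⟩
  · have h' : ((m₁ : ℚ) + m₂) ≠ 0 := by exact_mod_cast h.ne'
    refine ⟨a + b + m₂ * (k * n), ?_⟩
    push_cast
    rw [E, mul_div_cancel₀ _ h', ← ha, ← hb]; ring

end TateCurve

end

/-!
The product of the two series is the double sum over `(i₁, i₂) ∈ ℤ × ℤ` of the monomials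
`z^{m₁ w_a + m₂ w_b}` with `a = -p₁ + i₁ n` and `b = -p₂ + i₂ n`.  Since `p ↦ w_p` is a piecewise
linear convex function in each coordinate, `m₁ w_a + m₂ w_b` differs from `(m₁ + m₂) w_{E(a, b)}` by
the vector with coordinates `n λ((j - a)/n, (j - b)/n)`, which are nonnegative (`lam_nonneg`) and
integral (`exists_nat_eq_lam`); this is `mw_add_mw`.

The function `λ` is invariant under a simultaneous integral translation of its arguments
(`lam_add_int`), so this vector depends only on `k = i₁ - i₂`, while
`E(a, b) = -E(p₁, p₂ + k n) + i₁ n`.  Hence, after the change of variables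
`(i₁, i₂) ↔ (k, l) = (i₁ - i₂, i₁)`, the terms with fixed `k` add up to the `k`-th term of the product
formula.  On a given chart of a given thickening only finitely many pairs `(i₁, i₂)` contribute, by
`finite_support`, so the rearrangement takes place in a finite sum, and the partial sums over `k` are
eventually constant there, which is convergence in the topology of `FormalSections`.
-/

namespace TateCurve

/-! ### The weight function -/

theorem phi_add_int (t : ℚ) (k : ℤ) : phi (t + k) = phi t + k * t + k * (k - 1) / 2 := by
  simp only [phi, Int.floor_add_intCast]; push_cast; ring

theorem phi_eq_psi_floor (t : ℚ) : phi t = psi ⌊t⌋ t := by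
  simp only [phi, psi]; ring

theorem add_mul_E {m₁ m₂ : ℕ} (hm : m₁ + m₂ ≠ 0) (a b : ℚ) :
    ((m₁ : ℚ) + m₂) * E m₁ m₂ a b = m₁ * a + m₂ * b :=
  mul_div_cancel₀ _ (by exact_mod_cast hm)

theorem E_add_const {m₁ m₂ : ℕ} (hm : m₁ + m₂ ≠ 0) (a b c : ℚ) :
    E m₁ m₂ (a + c) (b + c) = E m₁ m₂ a b + c := by
  have h : ((m₁ : ℚ) + m₂) ≠ 0 := by exact_mod_cast hm
  simp only [E]; field_simp; ring

theorem E_sub_div {m₁ m₂ : ℕ} (hm : m₁ + m₂ ≠ 0) (x p q r : ℚ) :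
    E m₁ m₂ ((x - p) / r) ((x - q) / r) = (x - E m₁ m₂ p q) / r := by
  have h : ((m₁ : ℚ) + m₂) ≠ 0 := by exact_mod_cast hm
  simp only [E]; field_simp; ring

/-- `φ` changes by affine functions under integral translations, and these cancel in `λ`. -/
theorem lam_add_int {m₁ m₂ : ℕ} (hm : m₁ + m₂ ≠ 0) (a b : ℚ) (k : ℤ) :
    lam m₁ m₂ (a + k) (b + k) = lam m₁ m₂ a b := by
  simp only [lam, E_add_const hm, phi_add_int]
  linear_combination -(k : ℚ) * add_mul_E hm a b

/-- Convexity of `φ`: the linear piece of `φ` at `E(a, b)` lies below `φ` at `a` and at `b`. -/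
theorem lam_nonneg {m₁ m₂ : ℕ} (hm : m₁ + m₂ ≠ 0) (a b : ℚ) : 0 ≤ lam m₁ m₂ a b := by
  simp only [lam]
  rw [phi_eq_psi_floor (E m₁ m₂ a b)]
  have hE := add_mul_E hm a b
  generalize ⌊E m₁ m₂ a b⌋ = q
  have h₁ := mul_nonneg (Nat.cast_nonneg (α := ℚ) m₁) (sub_nonneg.2 (psi_le_phi q a))
  have h₂ := mul_nonneg (Nat.cast_nonneg (α := ℚ) m₂) (sub_nonneg.2 (psi_le_phi q b))
  have h₃ : ((m₁ : ℚ) + m₂) * psi q (E m₁ m₂ a b) = m₁ * psi q a + m₂ * psi q b := by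
    simp only [psi]
    linear_combination (q : ℚ) * hE
  linarith

theorem invMul_E' {m₁ m₂ : ℕ} {p q : ℚ} (hp : InvMul m₁ p) (hq : InvMul m₂ q) :
    InvMul (m₁ + m₂) (E m₁ m₂ p q) := by
  simpa using invMul_E 0 hp hq 0

section weights

variable {n : ℕ} [NeZero n]

/-- The coordinates of `m₁ w_p + m₂ w_q - (m₁ + m₂) w_{E(p, q)}` are values of `n λ`. -/
theorem mw_snd_add_sub {m₁ m₂ : ℕ} (hm : m₁ + m₂ ≠ 0) {p q : ℚ} (hp : InvMul m₁ p)
    (hq : InvMul m₂ q) (j : ZMod n) :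
    (((mw n m₁ p).2 j + (mw n m₂ q).2 j - (mw n (m₁ + m₂) (E m₁ m₂ p q)).2 j : ℤ) : ℚ)
      = n * lam m₁ m₂ ((j.val - p) / n) ((j.val - q) / n) := by
  push_cast
  rw [mw_snd hp, mw_snd hq, mw_snd (invMul_E' hp hq), lam, E_sub_div hm]
  push_cast; ring

theorem exists_nat_eq_lam {m₁ m₂ : ℕ} (hm : m₁ + m₂ ≠ 0) {p q : ℚ} (hp : InvMul m₁ p)
    (hq : InvMul m₂ q) (j : ZMod n) :
    ∃ d : ℕ, (d : ℚ) = n * lam m₁ m₂ ((j.val - p) / n) ((j.val - q) / n) := by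
  have h := mw_snd_add_sub hm hp hq j
  have h0 := mul_nonneg (Nat.cast_nonneg (α := ℚ) n)
    (lam_nonneg hm ((j.val - p) / n) ((j.val - q) / n))
  rw [← h] at h0 ⊢
  obtain ⟨d, hd⟩ := Int.eq_ofNat_of_zero_le (Int.cast_nonneg_iff.1 h0)
  exact ⟨d, by rw [hd, Int.cast_natCast]⟩

theorem mw_add_mw {m₁ m₂ : ℕ} (hm : m₁ + m₂ ≠ 0) {p q : ℚ} (hp : InvMul m₁ p)
    (hq : InvMul m₂ q) {d : ZMod n → ℕ}
    (hd : ∀ j, (d j : ℚ) = n * lam m₁ m₂ ((j.val - p) / n) ((j.val - q) / n)) :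
    mw n m₁ p + mw n m₂ q
      = mw n (m₁ + m₂) (E m₁ m₂ p q) + (0, fun j => (d j : ℤ)) := by
  ext j
  · have h : ((mw n m₁ p).1 + (mw n m₂ q).1 : ℚ) = (mw n (m₁ + m₂) (E m₁ m₂ p q)).1 := by
      rw [mw_fst hp, mw_fst hq, mw_fst (invMul_E' hp hq)]
      push_cast
      linear_combination add_mul_E hm p q
    simpa using (by exact_mod_cast h :
      (mw n m₁ p).1 + (mw n m₂ q).1 = (mw n (m₁ + m₂) (E m₁ m₂ p q)).1)
  · have h := (mw_snd_add_sub hm hp hq j).trans (hd j).symm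
    have h' : (mw n m₁ p).2 j + (mw n m₂ q).2 j - (mw n (m₁ + m₂) (E m₁ m₂ p q)).2 j = d j := by
      exact_mod_cast h
    simp only [Prod.snd_add, Pi.add_apply]
    linarith

end weights

/-! ### Products of monomial sections -/

theorem mono_zero {n : ℕ} (P : AddSubmonoid (Lattice n)) (N : ℕ) :
    mono P N 0 P.zero_mem = 1 :=
  map_one (Thick.mk P N)

theorem mono_pow {n : ℕ} (P : AddSubmonoid (Lattice n)) (N : ℕ) (u : Lattice n) (hu : u ∈ P)
    (k : ℕ) : mono P N u hu ^ k = mono P N (k • u) (nsmul_mem hu k) := by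
  simp only [mono, ← map_pow, AddMonoidAlgebra.single_pow, one_pow]; rfl

theorem mono_prod {n : ℕ} {ι : Type*} (P : AddSubmonoid (Lattice n)) (N : ℕ) (s : Finset ι)
    (u : ι → Lattice n) (hu : ∀ i, u i ∈ P) :
    ∏ i ∈ s, mono P N (u i) (hu i) = mono P N (∑ i ∈ s, u i) (sum_mem fun i _ => hu i) := by
  classical
  induction s using Finset.induction_on with
  | empty => exact (mono_zero P N).symm
  | insert a s ha ih =>
    rw [Finset.prod_insert ha, ih, mono_mul]
    exact mono_congr _ _ _ _ (Finset.sum_insert ha).symm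

section monomials

variable {n : ℕ} [NeZero n]

theorem tHom_prod_X_pow (i : ℤ) (N : ℕ) (d : ZMod n → ℕ) :
    tHom (chartMon n i) (e_mem_chart i) N (∏ j, MvPolynomial.X j ^ d j)
      = mono (chartMon n i) N (0, fun j => (d j : ℤ)) (nat_mem_chart i d) := by
  simp only [tHom, map_prod, map_pow, MvPolynomial.coe_eval₂Hom, MvPolynomial.eval₂_X, mono_pow]
  rw [mono_prod _ _ _ (fun j => d j • e j) fun j => nsmul_mem (e_mem_chart i j) _]
  refine mono_congr _ _ _ _ ?_
  ext k
  · simp [e, Prod.fst_sum]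
  · simp [e, Prod.snd_sum, Finset.sum_apply, Pi.single_apply]

/-- The product of `z^{m₁ w_p}` and `z^{m₂ w_q}` is `t^d z^{(m₁ + m₂) w_{E(p, q)}}`. -/
theorem zSec_mul_zSec {m₁ m₂ : ℕ} (hm : m₁ + m₂ ≠ 0) {p q r : ℚ} (hp : InvMul m₁ p)
    (hq : InvMul m₂ q) (hr : InvMul (m₁ + m₂) r) (hE : E m₁ m₂ p q = r) {d : ZMod n → ℕ}
    (hd : ∀ j, (d j : ℚ) = n * lam m₁ m₂ ((j.val - p) / n) ((j.val - q) / n)) (N : ℕ) (i : ℤ) :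
    (zSec n m₁ p hp).1 N i * (zSec n m₂ q hq).1 N i
      = (∏ j, (MvPolynomial.X j : Base n) ^ d j) • (zSec n (m₁ + m₂) r hr).1 N i := by
  subst hE
  rw [smul_def', tHom_prod_X_pow]
  simp only [zSec, mono_mul]
  refine mono_congr _ _ _ _ ?_
  have h := mw_add_mw (n := n) hm hp hq hd
  rw [add_smul, sub_add_sub_comm, h]
  abel

end monomials

/-! ### Convergence and the product formula -/

/-- A series of sections converges to `s` if on every chart of every thickening all but finitely many
terms vanish and the remaining ones add up to `s`. -/
theorem hasSum_tateSections {n : ℕ} [NeZero n] {m : ℕ} {ι : Type*} {f : ι → TateSections n m}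
    {s : TateSections n m}
    (hfin : ∀ N i, (Function.support fun k => (f k).1.1 N i).Finite)
    (hsum : ∀ N i, ∑ᶠ k, (f k).1.1 N i = s.1.1 N i) : HasSum f s := by
  rw [HasSum, Topology.IsInducing.subtypeVal.tendsto_nhds_iff]
  simp only [nhds_iInf, Filter.tendsto_iInf, SummationFilter.unconditional_filter]
  intro N i
  let _ : TopologicalSpace (Chart n i N) := ⊥
  have _ : DiscreteTopology (Chart n i N) := ⟨rfl⟩
  rw [nhds_induced, Filter.tendsto_comap_iff, nhds_discrete]
  refine Filter.tendsto_pure.2 ?_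
  filter_upwards [Filter.eventually_ge_atTop (hfin N i).toFinset] with A hA
  have hA' : Function.support (fun k => (f k).1.1 N i) ⊆ (A : Set ι) := fun k hk =>
    hA ((hfin N i).mem_toFinset.2 hk)
  rw [← hsum N i, finsum_eq_sum_of_support_subset _ hA']
  simp [Finset.sum_apply]

/-- The change of variables `(k, l) ↦ (i₁, i₂) = (l, l - k)`. -/
def sumIndexEquiv : ℤ × ℤ ≃ ℤ × ℤ where
  toFun x := (x.2, x.2 - x.1)
  invFun y := (y.1 - y.2, y.1)
  left_inv x := by ext <;> simp
  right_inv y := by ext <;> simp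

theorem finite_support_mul {ι κ R : Type*} [MulZeroClass R] {f : ι → R} {g : κ → R}
    (hf : (Function.support f).Finite) (hg : (Function.support g).Finite) :
    (Function.support fun x : ι × κ => f x.1 * g x.2).Finite :=
  (hf.prod hg).subset fun _ hx => ⟨left_ne_zero_of_mul hx, right_ne_zero_of_mul hx⟩

theorem finsum_mul_finsum {ι κ R : Type*} [NonUnitalNonAssocSemiring R] {f : ι → R} {g : κ → R}
    (hf : (Function.support f).Finite) (hg : (Function.support g).Finite) :
    (∑ᶠ i, f i) * ∑ᶠ j, g j = ∑ᶠ x : ι × κ, f x.1 * g x.2 := by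
  rw [finsum_curry _ (finite_support_mul hf hg), finsum_mul' _ _ hf]
  exact finsum_congr fun i => mul_finsum' _ _ hg

end TateCurve

open TateCurve in
theorem mainTheorem10 (n : ℕ) [NeZero n] (m₁ m₂ : ℕ) (hm₁ : 1 ≤ m₁) (hm₂ : 1 ≤ m₂)
    (p₁ p₂ : ℚ) (hp₁ : TateCurve.InvMul m₁ p₁) (hp₂ : TateCurve.InvMul m₂ p₂) :
    ∃ c : ℤ → ZMod n → ℕ,
      (∀ (k : ℤ) (j : ZMod n), (c k j : ℚ) =
        n * TateCurve.lam m₁ m₂ ((p₁ + j.val) / n) ((p₂ + j.val) / n + k)) ∧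
      HasSum
        (fun k : ℤ => (∏ j : ZMod n, (MvPolynomial.X j : TateCurve.Base n) ^ c k j) •
          TateCurve.theta n (m₁ + m₂) (le_add_right hm₁)
            (TateCurve.E m₁ m₂ p₁ (p₂ + k * n)) (TateCurve.invMul_E n hp₁ hp₂ k))
        (TateCurve.theta n m₁ hm₁ p₁ hp₁ * TateCurve.theta n m₂ hm₂ p₂ hp₂) := by
  have hn : (n : ℚ) ≠ 0 := by exact_mod_cast NeZero.ne n
  have hm : m₁ + m₂ ≠ 0 := by omega
  -- The weight of the pair `(i₁, i₂)` depends only on `i₁ - i₂`.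
  have hlam : ∀ (i₁ i₂ : ℤ) (x : ℚ),
      lam m₁ m₂ ((x - (-p₁ + i₁ * n)) / n) ((x - (-p₂ + i₂ * n)) / n)
        = lam m₁ m₂ ((p₁ + x) / n) ((p₂ + x) / n + (i₁ - i₂ : ℤ)) := by
    intro i₁ i₂ x
    rw [← lam_add_int hm _ _ i₁]
    congr 1 <;> (push_cast; field_simp; ring)
  have hc : ∀ (k : ℤ) (j : ZMod n), ∃ d : ℕ,
      (d : ℚ) = n * lam m₁ m₂ ((p₁ + j.val) / n) ((p₂ + j.val) / n + k) := by
    intro k j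
    obtain ⟨d, hd⟩ := exists_nat_eq_lam hm (hp₁.neg_add (n := n) k) (hp₂.neg_add (n := n) 0) j
    exact ⟨d, by rw [hd, hlam, sub_zero]⟩
  choose c hc using hc
  refine ⟨c, hc, ?_⟩
  -- On a chart, `F` is the double series of the product, `G` that of the right-hand side.
  let F : ∀ (N : ℕ) (i : ℤ), ℤ × ℤ → Chart n i N := fun N i x =>
    (zSec n m₁ (-p₁ + x.1 * n) (hp₁.neg_add x.1)).1 N i *
      (zSec n m₂ (-p₂ + x.2 * n) (hp₂.neg_add x.2)).1 N i
  let G : ∀ (N : ℕ) (i : ℤ), ℤ × ℤ → Chart n i N := fun N i x =>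
    (∏ j : ZMod n, (MvPolynomial.X j : Base n) ^ c x.1 j) •
      (zSec n (m₁ + m₂) (-E m₁ m₂ p₁ (p₂ + x.1 * n) + x.2 * n)
        ((invMul_E n hp₁ hp₂ x.1).neg_add x.2)).1 N i
  have hFG : ∀ N i x, F N i (sumIndexEquiv x) = G N i x := by
    rintro N i ⟨k, l⟩
    refine zSec_mul_zSec hm _ _ _ ?_ (fun j => ?_) N i
    · simp only [sumIndexEquiv, Equiv.coe_fn_mk, E]
      push_cast; field_simp; ring
    · rw [hc, hlam]
      simp only [sumIndexEquiv, Equiv.coe_fn_mk, sub_sub_cancel]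
  have hFfin : ∀ N i, (Function.support (F N i)).Finite := fun N i =>
    finite_support_mul (finite_support hm₁ hp₁ N i) (finite_support hm₂ hp₂ N i)
  have hGfin : ∀ N i, (Function.support (G N i)).Finite := by
    intro N i
    have h : G N i = F N i ∘ sumIndexEquiv := funext fun x => (hFG N i x).symm
    rw [h, Function.support_comp_eq_preimage]
    exact (hFfin N i).preimage sumIndexEquiv.injective.injOn
  have hterm : ∀ N i (k : ℤ), ((∏ j : ZMod n, (MvPolynomial.X j : Base n) ^ c k j) •
      theta n (m₁ + m₂) (le_add_right hm₁) (E m₁ m₂ p₁ (p₂ + k * n))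
        (invMul_E n hp₁ hp₂ k)).1.1 N i = ∑ᶠ l : ℤ, G N i (k, l) := by
    intro N i k
    refine (smul_def' i N _ _).trans ?_
    refine (mul_finsum' _ _ (finite_support (le_add_right hm₁) (invMul_E n hp₁ hp₂ k) N i)).trans ?_
    exact finsum_congr fun l => (smul_def' i N _ _).symm
  refine hasSum_tateSections (fun N i => ?_) fun N i => ?_
  · simp only [hterm]
    refine ((hGfin N i).image Prod.fst).subset fun k hk => ?_
    obtain ⟨l, hl⟩ : ∃ l, G N i (k, l) ≠ 0 := by
      by_contra! h
      exact hk (by simp only [h, finsum_zero])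
    exact ⟨(k, l), hl, rfl⟩
  · simp only [hterm]
    rw [← finsum_curry _ (hGfin N i), ← finsum_congr (hFG N i), finsum_comp_equiv sumIndexEquiv]
    exact (finsum_mul_finsum (finite_support hm₁ hp₁ N i) (finite_support hm₂ hp₂ N i)).symm
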